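/- All algebras and spaces are over $\mathbb{C}$, and $\widehat{\otimes}$ is the (completed) projective tensor product of Banach spaces. Let $A$ be a Banach algebra. For a Banach $A$-bimodule $M$ (a Banach space with commuting, associative left and right actions of $A$ that are bounded bilinear maps) and $n\ge 0$, put $C_n(A,M)=M\widehat{\otimes}A^{\widehat{\otimes} n}$, let $C^n(A,M)$ be the space of bounded $n$-linear maps $A^n\to M$, and let $\mathsf d_n:C_{n+1}(A,M)\to C_n(A,M)$ and $\delta_n:C^n(A,M)\to C^{n+1}(A,M)$ be the Hochschild operators \[ \begin{aligned} \mathsf d_n(x\otimes a_1\otimes\cdots\otimes a_{n+1})={}& xa_1\otimes a_2\otimes\cdots\otimes a_{n+1}+\sum_{j=1}^n(-1)^j x\otimes a_1\otimes\cdots\otimes a_ja_{j+1}\otimes\cdots\otimes a_{n+1}\\ &+(-1)^{n+1}a_{n+1}x\otimes a_1\otimes\cdots\otimes a_n,\\ (\delta_nF)(a_1,\dots,a_{n+1})={}& a_1\cdot F(a_2,\dots,a_{n+1})+\sum_{j=1}^n(-1)^jF(a_1,\dots,a_ja_{j+1},\dots,a_{n+1})\\ &+(-1)^{n+1}F(a_1,\dots,a_n)\cdot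 a_{n+1}. \end{aligned} \] For $n\ge1$ let $H_n(A,M)=\ker \mathsf d_{n-1}/\operatorname{im}\mathsf d_n$ and $H^n(A,M)=\ker\delta_n/\operatorname{im}\delta_{n-1}$. Write $C_n(A)=C_n(A,A)$, a left Banach $A$-module via $b\cdot(a_0\otimes a_1\otimes\cdots\otimes a_n)=ba_0\otimes a_1\otimes\cdots\otimes a_n$, and let $A'$ be the dual bimodule of $A$, with $(a\cdot\varphi)(b)=\varphi(ba)$ and $(\varphi\cdot a)(b)=\varphi(ab)$. The bimodule $M$ is symmetric if $a\cdot x=x\cdot a$ for all $a\in A$, $x\in M$, and, for $A$ unital, unit-linked if $1\cdot x=x=x\cdot 1$ for all $x\in M$. **Proposition.** Let $A$ be a unital commutative Banach algebra that is isomorphic as a Banach space (linearly homeomorphic) to $\ell^1(\Omega)$ for some set $\Omega$. The following are equivalent: - (a) $H^n(A,A')=0$ for all $n\ge1$; - (b) $H_n(A,A)=0$ for all $n\ge1$; - (c) the complex $0\leftarrow C_1(A)\xleftarrow{\mathsf d_1}C_2(A)\xleftarrow{\mathsf d_2}\cdots$ splits in the category of Banach spaces, that is, there are bounded linear maps $s_n:C_n(A)\to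 C_{n+1}(A)$ $(n\ge1)$ with $\mathsf d_1s_1=\mathrm{id}$ and $s_n\mathsf d_n+\mathsf d_{n+1}s_{n+1}=\mathrm{id}$ for all $n\ge1$; - (d) the same complex splits in the category of left Banach $A$-modules, that is, the maps $s_n$ in (c) can be chosen to be $A$-module maps; - (e1) $H^n(A,M)=0$ for all $n\ge1$ and every symmetric unit-linked Banach $A$-bimodule $M$; - (e2) $H_n(A,M)=0$ for all $n\ge1$ and every symmetric unit-linked Banach $A$-bimodule $M$. -/

import Mathlib

open scoped TensorProduct

noncomputable section

namespace BanachHochschild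

universe u v w

/-! ### The projective tensor product of two Banach spaces -/

section ProjectiveTensor

variable (E : Type u) (F : Type v)
  [NormedAddCommGroup E] [NormedSpace ℂ E] [NormedAddCommGroup F] [NormedSpace ℂ F]

/-- The algebraic tensor product `E ⊗ F`, to be equipped with the projective seminorm. -/
def AlgTensor : Type (max u v) := E ⊗[ℂ] F

instance : AddCommGroup (AlgTensor E F) := inferInstanceAs (AddCommGroup (E ⊗[ℂ] F))

instance : Module ℂ (AlgTensor E F) := inferInstanceAs (Module ℂ (E ⊗[ℂ] F))

variable {E F}

/-- The elementary tensor `x ⊗ y`. -/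
def AlgTensor.tmul (x : E) (y : F) : AlgTensor E F := x ⊗ₜ[ℂ] y

/-- The finite families `(xᵢ, yᵢ)` with `z = ∑ᵢ xᵢ ⊗ yᵢ`. -/
def AlgTensor.Rep (z : AlgTensor E F) : Type (max u v) :=
  {l : List (E × F) // (l.map fun p => AlgTensor.tmul p.1 p.2).sum = z}

/-- The number `∑ᵢ ‖xᵢ‖ ‖yᵢ‖` attached to a representation. -/
def AlgTensor.Rep.cost {z : AlgTensor E F} (r : AlgTensor.Rep z) : ℝ :=
  (r.1.map fun p => ‖p.1‖ * ‖p.2‖).sum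

theorem AlgTensor.Rep.cost_nonneg {z : AlgTensor E F} (r : AlgTensor.Rep z) : 0 ≤ r.cost := by
  refine List.sum_nonneg fun a ha => ?_
  obtain ⟨p, -, rfl⟩ := List.mem_map.1 ha
  positivity

instance (z : AlgTensor E F) : Nonempty (AlgTensor.Rep z) := by
  refine TensorProduct.induction_on (motive := fun z : E ⊗[ℂ] F =>
    Nonempty (AlgTensor.Rep (E := E) (F := F) z)) z ?_ ?_ ?_
  · exact ⟨⟨[], rfl⟩⟩
  · intro x y
    exact ⟨⟨[(x, y)], (add_zero _)⟩⟩
  · rintro x y ⟨r⟩ ⟨s⟩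
    refine ⟨⟨r.1 ++ s.1, ?_⟩⟩
    rw [List.map_append, List.sum_append, r.2, s.2]
    rfl

/-- The projective norm: the infimum of `∑ᵢ ‖xᵢ‖ ‖yᵢ‖` over all representations
`z = ∑ᵢ xᵢ ⊗ yᵢ`. -/
def AlgTensor.projNorm (z : AlgTensor E F) : ℝ := ⨅ r : AlgTensor.Rep z, r.cost

theorem AlgTensor.bddBelow_cost (z : AlgTensor E F) :
    BddBelow (Set.range fun r : AlgTensor.Rep z => r.cost) :=
  ⟨0, by rintro _ ⟨r, rfl⟩; exact r.cost_nonneg⟩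

theorem AlgTensor.projNorm_le {z : AlgTensor E F} (r : AlgTensor.Rep z) :
    AlgTensor.projNorm z ≤ r.cost :=
  ciInf_le (AlgTensor.bddBelow_cost z) r

theorem AlgTensor.projNorm_tmul_le (x : E) (y : F) :
    AlgTensor.projNorm (AlgTensor.tmul x y) ≤ ‖x‖ * ‖y‖ := by
  refine (AlgTensor.projNorm_le ⟨[(x, y)], by simp⟩).trans (le_of_eq ?_)
  simp [AlgTensor.Rep.cost]

/-- The projective norm as a seminorm. -/
def AlgTensor.projSeminorm : Seminorm ℂ (AlgTensor E F) :=
  Seminorm.ofSMulLE AlgTensor.projNorm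
    (le_antisymm
      ((AlgTensor.projNorm_le ⟨[], rfl⟩).trans (by simp [AlgTensor.Rep.cost]))
      (le_ciInf fun r => r.cost_nonneg))
    (fun x y => le_ciInf_add_ciInf fun r s =>
      (AlgTensor.projNorm_le (z := x + y)
        ⟨r.1 ++ s.1, by rw [List.map_append, List.sum_append, r.2, s.2]⟩).trans
        (by simp [AlgTensor.Rep.cost]))
    (fun c x => by
      rw [AlgTensor.projNorm.eq_def x, Real.mul_iInf_of_nonneg (norm_nonneg _)]
      refine le_ciInf fun r => ?_
      refine (AlgTensor.projNorm_le (z := c • x)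
        ⟨r.1.map fun p => (c • p.1, p.2), ?_⟩).trans (le_of_eq ?_)
      · conv_rhs => rw [← r.2, List.smul_sum]
        rw [List.map_map, List.map_map]
        rfl
      · simp [AlgTensor.Rep.cost, Function.comp_def, norm_smul, mul_assoc, List.sum_map_mul_left])

instance : SeminormedAddCommGroup (AlgTensor E F) :=
  (AlgTensor.projSeminorm (E := E) (F := F)).toAddGroupSeminorm.toSeminormedAddCommGroup

theorem AlgTensor.norm_def (z : AlgTensor E F) : ‖z‖ = AlgTensor.projNorm z := rfl

instance : NormedSpace ℂ (AlgTensor E F) where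
  norm_smul_le c z := (map_smul_eq_mul (AlgTensor.projSeminorm (E := E) (F := F)) c z).le

variable (E F)

/-- The projective tensor product `E ⊗̂ F`: the completion of the algebraic tensor product for the
projective norm. -/
abbrev ProjTensor : Type (max u v) := UniformSpace.Completion (AlgTensor E F)

/-- The canonical bounded bilinear map `(x, y) ↦ x ⊗ y` from `E × F` to `E ⊗̂ F`. -/
def projMk : E →L[ℂ] F →L[ℂ] ProjTensor E F :=
  LinearMap.mkContinuous₂
    (LinearMap.mk₂ ℂ (fun x y => ((AlgTensor.tmul x y : AlgTensor E F) : ProjTensor E F))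
      (fun x x' y => by
        rw [← UniformSpace.Completion.coe_add]
        exact congrArg _ (TensorProduct.add_tmul x x' y))
      (fun c x y => by
        rw [← UniformSpace.Completion.coe_smul]
        exact congrArg _ (TensorProduct.smul_tmul' c x y).symm)
      (fun x y y' => by
        rw [← UniformSpace.Completion.coe_add]
        exact congrArg _ (TensorProduct.tmul_add x y y'))
      (fun c x y => by
        rw [← UniformSpace.Completion.coe_smul]
        exact congrArg _ (TensorProduct.tmul_smul c x y)))
    1
    (fun x y => by
      rw [LinearMap.mk₂_apply, UniformSpace.Completion.norm_coe, one_mul]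
      exact AlgTensor.projNorm_tmul_le x y)

variable {E F}
variable {G : Type w} [NormedAddCommGroup G] [NormedSpace ℂ G]

/-- The linear map on the algebraic tensor product induced by a bounded bilinear map. -/
def algLift (f : E →L[ℂ] F →L[ℂ] G) : AlgTensor E F →ₗ[ℂ] G :=
  TensorProduct.lift (ContinuousLinearMap.toLinearMap₁₂ f)

@[simp]
theorem algLift_tmul (f : E →L[ℂ] F →L[ℂ] G) (x : E) (y : F) :
    algLift f (AlgTensor.tmul x y) = f x y :=
  TensorProduct.lift.tmul x y

theorem norm_algLift_le (f : E →L[ℂ] F →L[ℂ] G) (z : AlgTensor E F) :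
    ‖algLift f z‖ ≤ ‖f‖ * ‖z‖ := by
  rw [AlgTensor.norm_def, AlgTensor.projNorm, Real.mul_iInf_of_nonneg (norm_nonneg f)]
  refine le_ciInf fun r => ?_
  obtain ⟨l, rfl⟩ := r
  simp only [AlgTensor.Rep.cost]
  induction l with
  | nil => simp
  | cons p l ih =>
    simp only [List.map_cons, List.sum_cons, map_add, algLift_tmul, mul_add]
    refine (norm_add_le _ _).trans (add_le_add ?_ ih)
    rw [← mul_assoc]
    exact f.le_opNorm₂ p.1 p.2

variable [CompleteSpace G]

/-- The bounded linear map `E ⊗̂ F → G` induced by a bounded bilinear map `E × F → G`. -/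
def projLift (f : E →L[ℂ] F →L[ℂ] G) : ProjTensor E F →L[ℂ] G :=
  ((algLift f).mkContinuous ‖f‖ (norm_algLift_le f)).fromCompletion

@[simp]
theorem projLift_mk (f : E →L[ℂ] F →L[ℂ] G) (x : E) (y : F) :
    projLift f (projMk E F x y) = f x y :=
  (ContinuousLinearMap.fromCompletion_apply_coe _ _).trans (algLift_tmul f x y)

end ProjectiveTensor

/-! ### Projective tensor powers -/

section Power

variable (A : Type u) [NormedAddCommGroup A] [NormedSpace ℂ A]

/-- The `n`-th projective tensor power of `A`: the completion of the algebraic tensor power for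
the projective norm. For `n = 0` this is `ℂ`. -/
abbrev ProjPower (n : ℕ) : Type u := UniformSpace.Completion (⨂[ℂ] _ : Fin n, A)

/-- The canonical bounded multilinear map `(a₁, …, aₙ) ↦ a₁ ⊗ ⋯ ⊗ aₙ`. -/
def powMk (n : ℕ) : A [×n]→L[ℂ] ProjPower A n :=
  (UniformSpace.Completion.toComplL (𝕜 := ℂ)).compContinuousMultilinearMap
    (PiTensorProduct.tprodL ℂ (E := fun _ : Fin n => A))

variable {A}
variable {n : ℕ} {G : Type w} [NormedAddCommGroup G] [NormedSpace ℂ G] [CompleteSpace G]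

/-- Bounded `n`-linear maps on `A` induce bounded linear maps on the tensor power; this depends
linearly and boundedly on the multilinear map. -/
def powLift : (A [×n]→L[ℂ] G) →L[ℂ] (ProjPower A n →L[ℂ] G) :=
  LinearMap.mkContinuous
    { toFun := fun f => (PiTensorProduct.liftIsometry ℂ (fun _ : Fin n => A) G f).fromCompletion
      map_add' := fun f g => ContinuousLinearMap.fromCompletion_unique _ _ fun x => by simp
      map_smul' := fun c f => ContinuousLinearMap.fromCompletion_unique _ _ fun x => by simp }
    1
    (fun f => by
      refine ContinuousLinearMap.opNorm_le_bound _ (by positivity) fun x => ?_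
      induction x using UniformSpace.Completion.induction_on with
      | hp => exact isClosed_le (by fun_prop) (by fun_prop)
      | ih x =>
        simpa using PiTensorProduct.norm_eval_le_projectiveSeminorm f x)

@[simp]
theorem powLift_mk (f : A [×n]→L[ℂ] G) (a : Fin n → A) : powLift f (powMk A n a) = f a := by
  refine (ContinuousLinearMap.fromCompletion_apply_coe _ _).trans ?_
  simp

end Power

/-! ### Banach bimodules -/

section Bimodule

variable (A : Type u) [NormedRing A] [NormedAlgebra ℂ A]
variable (M : Type v) [NormedAddCommGroup M] [NormedSpace ℂ M]

/-- A Banach `A`-bimodule structure on `M`: `left a x` is `a · x`, `right a x` is `x · a`, and both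
actions are bounded bilinear maps. It is not assumed that the unit of `A` acts as the identity. -/
structure Bimodule where
  left : A →L[ℂ] M →L[ℂ] M
  right : A →L[ℂ] M →L[ℂ] M
  left_mul : ∀ (a b : A) (x : M), left (a * b) x = left a (left b x)
  right_mul : ∀ (a b : A) (x : M), right (a * b) x = right b (right a x)
  left_right : ∀ (a b : A) (x : M), left a (right b x) = right b (left a x)

variable {A M}

/-- `1 · x = x = x · 1` for all `x`. -/
def Bimodule.IsUnitLinked (B : Bimodule A M) : Prop :=
  ∀ x : M, B.left 1 x = x ∧ B.right 1 x = x

/-- `a · x = x · a` for all `a` and `x`. -/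
def Bimodule.IsSymmetric (B : Bimodule A M) : Prop :=
  ∀ (a : A) (x : M), B.left a x = B.right a x

variable (A)

/-- `A` as a bimodule over itself, by multiplication. -/
def Bimodule.regular : Bimodule A A where
  left := ContinuousLinearMap.mul ℂ A
  right := (ContinuousLinearMap.mul ℂ A).flip
  left_mul a b x := by simp [mul_assoc]
  right_mul a b x := by simp [mul_assoc]
  left_right a b x := by simp [mul_assoc]

variable {A}

/-- The dual bimodule `M'`: `(a · φ)(x) = φ(x · a)` and `(φ · a)(x) = φ(a · x)`. -/
def Bimodule.dual (B : Bimodule A M) : Bimodule A (StrongDual ℂ M) where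
  left := ((ContinuousLinearMap.compL ℂ M M ℂ).flip).comp B.right
  right := ((ContinuousLinearMap.compL ℂ M M ℂ).flip).comp B.left
  left_mul a b φ := by ext x; simp [B.right_mul]
  right_mul a b φ := by ext x; simp [B.left_mul]
  left_right a b φ := by ext x; simp [B.left_right]

@[simp]
theorem Bimodule.dual_left_apply (B : Bimodule A M) (a : A) (φ : StrongDual ℂ M) (x : M) :
    B.dual.left a φ x = φ (B.right a x) := rfl

@[simp]
theorem Bimodule.dual_right_apply (B : Bimodule A M) (a : A) (φ : StrongDual ℂ M) (x : M) :
    B.dual.right a φ x = φ (B.left a x) := rfl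

end Bimodule

/-! ### Multiplying two neighbouring arguments -/

section Contract

variable {A : Type u} [NormedRing A]

/-- `(a₀, …, aₙ) ↦ (a₀, …, aⱼ aⱼ₊₁, …, aₙ)`. -/
def mulAt {n : ℕ} (j : Fin n) (a : Fin (n + 1) → A) : Fin n → A :=
  Fin.contractNth j.castSucc (· * ·) a

/-- The effect on the new entry of changing the `i`-th entry of `a` to `x`. -/
def mulAtEntry {n : ℕ} (j : Fin n) (a : Fin (n + 1) → A) (i : Fin (n + 1)) (x : A) : A :=
  if i = j.castSucc then x * a j.succ else if i = j.succ then a j.castSucc * x else x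

theorem mulAt_update {n : ℕ} (j : Fin n) (a : Fin (n + 1) → A) (i : Fin (n + 1)) (x : A) :
    mulAt j (Function.update a i x)
      = Function.update (mulAt j a) (j.predAbove i) (mulAtEntry j a i x) := by
  funext k
  simp only [mulAt, mulAtEntry, Fin.contractNth, Function.update_apply, Fin.predAbove, Fin.ext_iff,
    Fin.lt_def, Fin.val_castSucc, Fin.val_succ]
  split_ifs <;> simp_all <;> first | omega | (obtain rfl : k = j := Fin.ext ‹_›; rfl)

theorem prod_norm_mulAt_le {n : ℕ} (j : Fin n) (a : Fin (n + 1) → A) :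
    ∏ k, ‖mulAt j a k‖ ≤ ∏ i, ‖a i‖ := by
  have h : ∀ k, ‖mulAt j a k‖ ≤
      (if k = j then ‖a j.castSucc‖ else 1) * ‖a (j.castSucc.succAbove k)‖ := by
    intro k
    by_cases hk : k = j
    · subst hk
      rw [mulAt, Fin.contractNth_apply_of_eq _ _ _ _ (by simp), if_pos rfl,
        Fin.succAbove_castSucc_self]
      exact norm_mul_le _ _
    · rw [mulAt, Fin.contractNth_apply_of_ne _ _ _ _
        (by simpa [Fin.ext_iff, eq_comm] using hk), if_neg hk, one_mul]
  refine (Finset.prod_le_prod (fun k _ => norm_nonneg _) fun k _ => h k).trans (le_of_eq ?_)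
  rw [Finset.prod_mul_distrib, Finset.prod_ite_eq', Fin.prod_univ_succAbove _ j.castSucc]
  simp

variable [NormedAlgebra ℂ A] {G : Type w} [NormedAddCommGroup G] [NormedSpace ℂ G]

/-- `F ↦ ((a₀, …, aₙ) ↦ F(a₀, …, aⱼ aⱼ₊₁, …, aₙ))` on bounded multilinear maps. -/
def contract {n : ℕ} (j : Fin n) : (A [×n]→L[ℂ] G) →L[ℂ] (A [×(n + 1)]→L[ℂ] G) :=
  MultilinearMap.mkContinuousLinear
    { toFun := fun f =>
        { toFun := fun a => f (mulAt j a)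
          map_update_add' := by
            intro inst a i x y
            obtain rfl := Subsingleton.elim inst (instDecidableEqFin (n + 1))
            have h : mulAtEntry j a i (x + y) = mulAtEntry j a i x + mulAtEntry j a i y := by
              unfold mulAtEntry
              split_ifs <;> simp [add_mul, mul_add]
            simp only [mulAt_update, h, ContinuousMultilinearMap.map_update_add]
          map_update_smul' := by
            intro inst a i c x
            obtain rfl := Subsingleton.elim inst (instDecidableEqFin (n + 1))
            have h : mulAtEntry j a i (c • x) = c • mulAtEntry j a i x := by
              unfold mulAtEntry
              split_ifs <;> simp
            simp only [mulAt_update, h, ContinuousMultilinearMap.map_update_smul] }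
      map_add' := fun f g => by ext; simp
      map_smul' := fun c f => by ext; simp }
    1
    (fun f a => by
      rw [one_mul]
      exact (f.le_opNorm _).trans
        (mul_le_mul_of_nonneg_left (prod_norm_mulAt_le j a) (norm_nonneg _)))

@[simp]
theorem contract_apply {n : ℕ} (j : Fin n) (f : A [×n]→L[ℂ] G) (a : Fin (n + 1) → A) :
    contract j f a = f (mulAt j a) := rfl

end Contract

/-! ### Hochschild cochains -/

section Cochains

variable {A : Type u} [NormedRing A] [NormedAlgebra ℂ A]
variable {M : Type v} [NormedAddCommGroup M] [NormedSpace ℂ M]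

/-- The bounded `n`-cochains: bounded `n`-linear maps from `A` to `M`. -/
abbrev Cochain (A : Type u) [NormedRing A] [NormedAlgebra ℂ A]
    (M : Type v) [NormedAddCommGroup M] [NormedSpace ℂ M] (n : ℕ) : Type (max u v) :=
  A [×n]→L[ℂ] M

/-- `(a₁, …, aₙ₊₁) ↦ a₁ · F(a₂, …, aₙ₊₁)`. -/
def Bimodule.firstTerm (B : Bimodule A M) (n : ℕ) (F : Cochain A M n) : Cochain A M (n + 1) :=
  ((B.left.flip.compContinuousMultilinearMap F).flipLinear).uncurryLeft

/-- `(a₁, …, aₙ₊₁) ↦ F(a₁, …, aₙ) · aₙ₊₁`. -/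
def Bimodule.lastTerm (B : Bimodule A M) (n : ℕ) (F : Cochain A M n) : Cochain A M (n + 1) :=
  (B.right.flip.compContinuousMultilinearMap F).uncurryRight

theorem Bimodule.firstTerm_apply (B : Bimodule A M) (n : ℕ) (F : Cochain A M n)
    (a : Fin (n + 1) → A) : B.firstTerm n F a = B.left (a 0) (F (Fin.tail a)) := rfl

theorem Bimodule.lastTerm_apply (B : Bimodule A M) (n : ℕ) (F : Cochain A M n)
    (a : Fin (n + 1) → A) : B.lastTerm n F a = B.right (a (Fin.last n)) (F (Fin.init a)) := rfl

/-- The Hochschild coboundary operator `δₙ`. -/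
def Bimodule.coboundary (B : Bimodule A M) (n : ℕ) : Cochain A M n →ₗ[ℂ] Cochain A M (n + 1) where
  toFun F := B.firstTerm n F + ∑ j : Fin n, (-1 : ℂ) ^ ((j : ℕ) + 1) • contract j F
    + (-1 : ℂ) ^ (n + 1) • B.lastTerm n F
  map_add' F F' := by
    have h₁ : B.firstTerm n (F + F') = B.firstTerm n F + B.firstTerm n F' := by
      ext a; simp [firstTerm_apply]
    have h₂ : B.lastTerm n (F + F') = B.lastTerm n F + B.lastTerm n F' := by
      ext a; simp [lastTerm_apply]
    simp only [h₁, h₂, map_add, smul_add, Finset.sum_add_distrib]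
    abel
  map_smul' c F := by
    have h₁ : B.firstTerm n (c • F) = c • B.firstTerm n F := by
      ext a; simp [firstTerm_apply]
    have h₂ : B.lastTerm n (c • F) = c • B.lastTerm n F := by
      ext a; simp [lastTerm_apply]
    simp only [h₁, h₂, map_smul, smul_add, Finset.smul_sum, RingHom.id_apply, smul_comm c]

theorem Bimodule.coboundary_apply (B : Bimodule A M) (n : ℕ) (F : Cochain A M n)
    (a : Fin (n + 1) → A) :
    B.coboundary n F a = B.left (a 0) (F (Fin.tail a))
      + ∑ j : Fin n, (-1 : ℂ) ^ ((j : ℕ) + 1) • F (mulAt j a)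
      + (-1 : ℂ) ^ (n + 1) • B.right (a (Fin.last n)) (F (Fin.init a)) := by
  simp only [Bimodule.coboundary, LinearMap.coe_mk, AddHom.coe_mk,
    _root_.add_apply, _root_.smul_apply,
    _root_.sum_apply, contract_apply]
  rfl

/-- The image of the incoming coboundary operator in degree `n`. -/
def Bimodule.coboundaries (B : Bimodule A M) : (n : ℕ) → Submodule ℂ (Cochain A M n)
  | 0 => ⊥
  | n + 1 => LinearMap.range (B.coboundary n)

/-- The kernel of the outgoing coboundary operator in degree `n`. -/
def Bimodule.cocycles (B : Bimodule A M) (n : ℕ) : Submodule ℂ (Cochain A M n) :=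
  LinearMap.ker (B.coboundary n)

/-- The Hochschild cohomology group `Hⁿ(A, M) = ker δₙ / im δₙ₋₁`. -/
abbrev Bimodule.Cohomology (B : Bimodule A M) (n : ℕ) : Type (max u v) :=
  B.cocycles n ⧸ (B.coboundaries n).submoduleOf (B.cocycles n)

end Cochains

/-! ### Hochschild chains -/

section Chains

variable (A : Type u) [NormedRing A] [NormedAlgebra ℂ A]
variable (M : Type v) [NormedAddCommGroup M] [NormedSpace ℂ M]

/-- The continuous `n`-chains `M ⊗̂ A ⊗̂ ⋯ ⊗̂ A`. -/
abbrev Chain (n : ℕ) : Type (max u v) := ProjTensor M (ProjPower A n)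

/-- `x ↦ ((a₁, …, aₙ) ↦ x ⊗ a₁ ⊗ ⋯ ⊗ aₙ)`. -/
def chainMk (n : ℕ) : M →L[ℂ] (A [×n]→L[ℂ] Chain A M n) :=
  ((projMk M (ProjPower A n)).flip.compContinuousMultilinearMap (powMk A n)).flipLinear

variable {A M}

theorem chainMk_apply (n : ℕ) (x : M) (a : Fin n → A) :
    chainMk A M n x a = projMk M (ProjPower A n) x (powMk A n a) := rfl

variable {G : Type w} [NormedAddCommGroup G] [NormedSpace ℂ G] [CompleteSpace G]

/-- The bounded linear map on `n`-chains with prescribed values on elementary tensors. -/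
def chainLift {n : ℕ} (f : M →L[ℂ] (A [×n]→L[ℂ] G)) : Chain A M n →L[ℂ] G :=
  projLift (powLift.comp f)

@[simp]
theorem chainLift_mk {n : ℕ} (f : M →L[ℂ] (A [×n]→L[ℂ] G)) (x : M) (a : Fin n → A) :
    chainLift f (chainMk A M n x a) = f x a := by
  simp [chainLift, chainMk_apply]

/-- `x ↦ ((a₁, …, aₙ₊₁) ↦ (x · a₁) ⊗ a₂ ⊗ ⋯ ⊗ aₙ₊₁)`. -/
def Bimodule.firstFace (B : Bimodule A M) (n : ℕ) : M →L[ℂ] (A [×(n + 1)]→L[ℂ] Chain A M n) :=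
  ((continuousMultilinearCurryLeftEquiv ℂ (fun _ : Fin (n + 1) => A)
      (Chain A M n)).symm.toContinuousLinearEquiv.toContinuousLinearMap).comp
    ((ContinuousLinearMap.compL ℂ A M (A [×n]→L[ℂ] Chain A M n) (chainMk A M n)).comp
      B.right.flip)

/-- `x ↦ ((a₁, …, aₙ₊₁) ↦ (aₙ₊₁ · x) ⊗ a₁ ⊗ ⋯ ⊗ aₙ)`. -/
def Bimodule.lastFace (B : Bimodule A M) (n : ℕ) : M →L[ℂ] (A [×(n + 1)]→L[ℂ] Chain A M n) :=
  ((continuousMultilinearCurryRightEquiv ℂ (fun _ : Fin (n + 1) => A)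
      (Chain A M n)).symm.toContinuousLinearEquiv.toContinuousLinearMap).comp
    (((ContinuousLinearMap.flipMultilinearEquiv ℂ (fun _ : Fin n => A) A
        (Chain A M n)).toContinuousLinearMap).comp
      ((ContinuousLinearMap.compL ℂ A M (A [×n]→L[ℂ] Chain A M n) (chainMk A M n)).comp
        B.left.flip))

/-- The Hochschild boundary operator `dₙ`. -/
def Bimodule.boundary (B : Bimodule A M) (n : ℕ) : Chain A M (n + 1) →L[ℂ] Chain A M n :=
  chainLift (B.firstFace n
    + ∑ j : Fin n, (-1 : ℂ) ^ ((j : ℕ) + 1) • (contract j).comp (chainMk A M n)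
    + (-1 : ℂ) ^ (n + 1) • B.lastFace n)

theorem Bimodule.boundary_mk (B : Bimodule A M) (n : ℕ) (x : M) (a : Fin (n + 1) → A) :
    B.boundary n (chainMk A M (n + 1) x a) = chainMk A M n (B.right (a 0) x) (Fin.tail a)
      + ∑ j : Fin n, (-1 : ℂ) ^ ((j : ℕ) + 1) • chainMk A M n x (mulAt j a)
      + (-1 : ℂ) ^ (n + 1) • chainMk A M n (B.left (a (Fin.last n)) x) (Fin.init a) := by
  rw [Bimodule.boundary, chainLift_mk]
  simp only [_root_.add_apply, _root_.smul_apply,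
    _root_.sum_apply, _root_.add_apply,
    _root_.smul_apply, _root_.sum_apply,
    ContinuousLinearMap.comp_apply, contract_apply]
  rfl

/-- The kernel of the outgoing boundary operator in degree `n`. -/
def Bimodule.cycles (B : Bimodule A M) : (n : ℕ) → Submodule ℂ (Chain A M n)
  | 0 => ⊤
  | n + 1 => LinearMap.ker (B.boundary n).toLinearMap

/-- The image of the incoming boundary operator in degree `n`. -/
def Bimodule.boundaries (B : Bimodule A M) (n : ℕ) : Submodule ℂ (Chain A M n) :=
  LinearMap.range (B.boundary n).toLinearMap

/-- The Hochschild homology group `Hₙ(A, M) = ker dₙ₋₁ / im dₙ`. -/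
abbrev Bimodule.Homology (B : Bimodule A M) (n : ℕ) : Type (max u v) :=
  B.cycles n ⧸ (B.boundaries n).submoduleOf (B.cycles n)

/-- The left action `b · (x ⊗ a₁ ⊗ ⋯ ⊗ aₙ) = (b · x) ⊗ a₁ ⊗ ⋯ ⊗ aₙ` on chains. -/
def Bimodule.chainAct (B : Bimodule A M) (n : ℕ) (b : A) : Chain A M n →L[ℂ] Chain A M n :=
  chainLift ((chainMk A M n).comp (B.left b))

@[simp]
theorem Bimodule.chainAct_mk (B : Bimodule A M) (n : ℕ) (b : A) (x : M) (a : Fin n → A) :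
    B.chainAct n b (chainMk A M n x a) = chainMk A M n (B.left b x) a := by
  simp [Bimodule.chainAct]

end Chains

/-! ### Splitting of chain complexes -/

section Splitting

variable {X : ℕ → Type v} [∀ n, NormedAddCommGroup (X n)] [∀ n, NormedSpace ℂ (X n)]

/-- `s` is a contracting homotopy of the complex `0 ← X 0 ← X 1 ← X 2 ← ⋯` with differentials
`d n : X (n + 1) → X n`. -/
structure IsContractingHomotopy (d : ∀ n, X (n + 1) →L[ℂ] X n)
    (s : ∀ n, X n →L[ℂ] X (n + 1)) : Prop where
  zero : (d 0).comp (s 0) = ContinuousLinearMap.id ℂ (X 0)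
  succ : ∀ n, (s n).comp (d n) + (d (n + 1)).comp (s (n + 1))
    = ContinuousLinearMap.id ℂ (X (n + 1))

/-- The complex splits in the category of Banach spaces and bounded linear maps. -/
def SplitsAsBanachSpaces (d : ∀ n, X (n + 1) →L[ℂ] X n) : Prop :=
  ∃ s : ∀ n, X n →L[ℂ] X (n + 1), IsContractingHomotopy d s

/-- The complex splits in the category of left Banach `A`-modules and bounded `A`-module maps,
`act n a` being the action of `a` on `X n`. -/
def SplitsAsBanachModules {A : Type u} (act : ∀ n, A → X n →L[ℂ] X n)
    (d : ∀ n, X (n + 1) →L[ℂ] X n) : Prop :=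
  ∃ s : ∀ n, X n →L[ℂ] X (n + 1), IsContractingHomotopy d s ∧
    ∀ (n : ℕ) (a : A) (x : X n), s n (act n a x) = act (n + 1) a (s n x)

end Splitting

/-! ### Simplicial chains and cochains -/

section Simplicial

variable (A : Type u) [NormedRing A] [NormedAlgebra ℂ A]

/-- Simplicial homology `Hₙ(A, A)`. -/
abbrev SimplicialHomology (n : ℕ) : Type u := (Bimodule.regular A).Homology n

/-- Simplicial cohomology `Hⁿ(A, A')`. -/
abbrev SimplicialCohomology (n : ℕ) : Type u := (Bimodule.regular A).dual.Cohomology n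

/-- The differentials of `0 ← C₁(A, A) ← C₂(A, A) ← ⋯`; the term in position `n` is
`Cₙ₊₁(A, A)`. -/
def truncatedBoundary (n : ℕ) : Chain A A (n + 1 + 1) →L[ℂ] Chain A A (n + 1) :=
  (Bimodule.regular A).boundary (n + 1)

/-- The left `A`-module action `b · (a₀ ⊗ a₁ ⊗ ⋯) = b a₀ ⊗ a₁ ⊗ ⋯` on the terms of the truncated
complex. -/
def truncatedAct (n : ℕ) (b : A) : Chain A A (n + 1) →L[ℂ] Chain A A (n + 1) :=
  (Bimodule.regular A).chainAct (n + 1) b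

end Simplicial

end BanachHochschild

end

/-!
If the cohomology with values in `A'` vanishes, then the dual of the complex `Cₙ(A)` is exact in
positive degrees. Its coboundaries therefore have closed range, and Hahn–Banach together with a
successive approximation argument makes `Cₙ(A)` itself exact: (a) ⇒ (b).

As a left `A`-module, `Cₙ(A)` is free on the `n`-th tensor power of `A`. Since `A ≅ ℓ¹(Ω)`
lifts through surjections of Banach spaces, so do its tensor powers, and module maps out of `Cₙ(A)`
lift through the boundary onto its kernel. A contracting homotopy by module maps is then built
degree by degree: (b) ⇒ (d).

For symmetric unit-linked `M` the chain and cochain complexes with coefficients in `M` are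
`M ⊗_A Cₙ(A)` and `Hom_A(Cₙ(A), M)`. Both functors preserve a homotopy made of module maps, so
(d) ⇒ (e1), (e2).
-/

noncomputable section

namespace BanachHochschild

universe u v w

/-! ### Exactness by duality -/

section Duality

theorem surjective_of_approx_preimage {𝕜 : Type*} [NormedField 𝕜]
    {X : Type*} [NormedAddCommGroup X] [NormedSpace 𝕜 X] [CompleteSpace X]
    {Y : Type*} [NormedAddCommGroup Y] [NormedSpace 𝕜 Y] (T : X →L[𝕜] Y) {C : ℝ}
    (h : ∀ y, ∃ x, ‖y - T x‖ ≤ 1 / 2 * ‖y‖ ∧ ‖x‖ ≤ C * ‖y‖) : Function.Surjective T := by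
  choose g hg hgC using h
  intro y
  let r : ℕ → Y := fun n => (fun z => z - T (g z))^[n] y
  have r_succ (n : ℕ) : r (n + 1) = r n - T (g (r n)) := Function.iterate_succ_apply' _ n y
  have norm_r (n : ℕ) : ‖r n‖ ≤ (1 / 2) ^ n * ‖y‖ := by
    induction n with
    | zero => simp [r]
    | succ n ih =>
      rw [r_succ, pow_succ']
      linarith [hg (r n)]
  have hsum : Summable fun n => g (r n) := by
    refine Summable.of_norm_bounded (summable_geometric_two.mul_right (|C| * ‖y‖)) fun n => ?_
    calc ‖g (r n)‖ ≤ C * ‖r n‖ := hgC _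
      _ ≤ |C| * ((1 / 2) ^ n * ‖y‖) := by gcongr; exacts [le_abs_self C, norm_r n]
      _ = (1 / 2) ^ n * (|C| * ‖y‖) := by ring
  have telescope (n : ℕ) : T (∑ i ∈ Finset.range n, g (r i)) = y - r n := by
    induction n with
    | zero => simp [r]
    | succ n ih => rw [Finset.sum_range_succ, map_add, ih, r_succ]; abel
  have r_tendsto : Filter.Tendsto r Filter.atTop (nhds 0) :=
    squeeze_zero_norm norm_r (by
      simpa using (tendsto_pow_atTop_nhds_zero_of_lt_one (r := (1 / 2 : ℝ))
        (by norm_num) (by norm_num)).mul_const ‖y‖)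
  refine ⟨∑' n, g (r n), tendsto_nhds_unique
    ((T.continuous.tendsto _).comp hsum.hasSum.tendsto_sum_nat) ?_⟩
  simpa only [Function.comp_def, telescope, sub_zero] using r_tendsto.const_sub y

variable {𝕜 : Type*} [RCLike 𝕜]
  {W : Type*} [NormedAddCommGroup W] [NormedSpace 𝕜 W]
  {X : Type*} [NormedAddCommGroup X] [NormedSpace 𝕜 X]
  {Y : Type*} [NormedAddCommGroup Y] [NormedSpace 𝕜 Y]
  {Z : Type*} [NormedAddCommGroup Z] [NormedSpace 𝕜 Z]

/-- The transpose `f ↦ f ∘ T` of a bounded operator `T`, acting on dual spaces. -/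
def dualMap (T : X →L[𝕜] Y) : StrongDual 𝕜 Y →L[𝕜] StrongDual 𝕜 X :=
  ContinuousLinearMap.precomp 𝕜 T

@[simp]
theorem dualMap_apply (T : X →L[𝕜] Y) (f : StrongDual 𝕜 Y) (x : X) : dualMap T f x = f (T x) := rfl

theorem exists_dual_norm_lt_of_notMem_closure_image_closedBall (T : X →L[𝕜] Y) {r : ℝ} {y : Y}
    (hy : y ∉ closure (T '' Metric.closedBall 0 r)) :
    ∃ (f : StrongDual 𝕜 Y) (u : ℝ), (∀ x ∈ Metric.closedBall 0 r, ‖f (T x)‖ ≤ u) ∧ u < ‖f y‖ := by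
  let _ : NormedSpace ℝ X := NormedSpace.restrictScalars ℝ 𝕜 X
  let _ : NormedSpace ℝ Y := NormedSpace.restrictScalars ℝ 𝕜 Y
  have hconv : Convex ℝ (closure (T '' Metric.closedBall 0 r)) :=
    ((convex_closedBall (0 : X) r).linear_image (T.toLinearMap.restrictScalars ℝ)).closure
  obtain ⟨f, u, hfu, huy⟩ :=
    RCLike.geometric_hahn_banach_closed_point (𝕜 := 𝕜) hconv isClosed_closure hy
  refine ⟨f, u, fun x hx => ?_, huy.trans_le (RCLike.re_le_norm _)⟩
  -- The ball is balanced, so `x` may be rotated until `f (T x)` is real and nonnegative.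
  obtain ⟨c, hc, hcx⟩ := RCLike.exists_norm_eq_mul_self (f (T x))
  have hmem : T (c • x) ∈ closure (T '' Metric.closedBall 0 r) :=
    subset_closure ⟨c • x, by simpa [norm_smul, hc] using hx, rfl⟩
  simpa [← hcx] using (hfu _ hmem).le

theorem surjective_of_dual_bounded_below [CompleteSpace X] (T : X →L[𝕜] Y) {K : ℝ} (hK : 0 < K)
    (h : ∀ f : StrongDual 𝕜 Y, ‖f‖ ≤ K * ‖dualMap T f‖) : Function.Surjective T := by
  refine surjective_of_approx_preimage T (C := K) fun y => ?_
  obtain rfl | hy := eq_or_ne y 0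
  · exact ⟨0, by simp⟩
  have : 0 < ‖y‖ := norm_pos_iff.2 hy
  suffices hmem : y ∈ closure (T '' Metric.closedBall 0 (K * ‖y‖)) by
    obtain ⟨_, ⟨x, hx, rfl⟩, hxy⟩ := Metric.mem_closure_iff.1 hmem (1 / 2 * ‖y‖) (by positivity)
    exact ⟨x, by simpa only [dist_eq_norm] using hxy.le, by simpa using hx⟩
  by_contra hmem
  obtain ⟨f, u, hfu, huy⟩ := exists_dual_norm_lt_of_notMem_closure_image_closedBall T hmem
  refine huy.not_ge ?_
  calc ‖f y‖ ≤ ‖f‖ * ‖y‖ := f.le_opNorm y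
    _ ≤ K * ‖dualMap T f‖ * ‖y‖ := by gcongr; exact h f
    _ ≤ K * (u / (K * ‖y‖)) * ‖y‖ := by
      gcongr
      exact (dualMap T f).opNorm_bound_of_ball_bound (by positivity) u hfu
    _ = u := by field_simp

theorem surjective_of_dual_injective_of_isClosed_range [CompleteSpace X] (T : X →L[𝕜] Y)
    (hinj : Function.Injective (dualMap T)) (hclosed : IsClosed (Set.range (dualMap T))) :
    Function.Surjective T := by
  obtain ⟨K, hK⟩ := (dualMap T).antilipschitz_of_injective_of_isClosed_range hinj hclosed
  refine surjective_of_dual_bounded_below T (K := K + 1) (by positivity) fun f => ?_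
  exact ((dualMap T).bound_of_antilipschitz hK f).trans
    (mul_le_mul_of_nonneg_right (by simp) (norm_nonneg _))

theorem exact_of_dual_exact [CompleteSpace X] [CompleteSpace Y] {R : W →L[𝕜] X} {T : X →L[𝕜] Y}
    {S : Y →L[𝕜] Z}
    (hY : Function.Exact (dualMap S) (dualMap T))
    (hX : Function.Exact (dualMap T) (dualMap R)) :
    Function.Exact T S := by
  have hST (x : X) : S (T x) = 0 := SeparatingDual.eq_zero_of_forall_dual_eq_zero (R := 𝕜) fun g =>
    DFunLike.congr_fun (hY.apply_apply_eq_zero g) x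
  let T₀ : X →L[𝕜] S.ker := T.codRestrict S.ker hST
  have hinj : Function.Injective (dualMap T₀) := by
    refine (injective_iff_map_eq_zero _).2 fun f hf => ?_
    obtain ⟨F, hF, -⟩ := exists_extension_norm_eq S.ker f
    obtain ⟨g, rfl⟩ := (hY F).1 (ContinuousLinearMap.ext fun x =>
      (hF (T₀ x)).trans (DFunLike.congr_fun hf x))
    ext k
    have hk : S k = 0 := k.2
    rw [← hF k]
    simp [hk]
  have hrange : Set.range (dualMap T₀) = dualMap R ⁻¹' {0} := by
    ext φ
    refine Iff.trans ⟨?_, ?_⟩ (hX φ).symm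
    · rintro ⟨f, rfl⟩
      obtain ⟨F, hF, -⟩ := exists_extension_norm_eq S.ker f
      exact ⟨F, ContinuousLinearMap.ext fun x => hF (T₀ x)⟩
    · rintro ⟨F, rfl⟩
      exact ⟨F.comp S.ker.subtypeL, rfl⟩
  have : CompleteSpace S.ker := S.isClosed_ker.completeSpace_coe
  have hsurj := surjective_of_dual_injective_of_isClosed_range T₀ hinj
    (hrange ▸ isClosed_singleton.preimage (ContinuousLinearMap.continuous _))
  refine fun y => ⟨fun hy => ?_, ?_⟩
  · obtain ⟨x, hx⟩ := hsurj ⟨y, hy⟩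
    exact ⟨x, congrArg Subtype.val hx⟩
  · rintro ⟨x, rfl⟩
    exact hST x

end Duality

/-! ### The lifting property -/

section Lifting

variable {𝕜 : Type*} [NontriviallyNormedField 𝕜]

variable (𝕜) in
/-- The lifting property (projectivity) of a Banach space `E`: bounded operators out of `E` lift
through bounded surjections of Banach spaces. Only Banach spaces in the universe of `E` are
tested. -/
def HasLifting (E : Type u) [NormedAddCommGroup E] [NormedSpace 𝕜 E] : Prop :=
  ∀ (Z Y : Type u) [NormedAddCommGroup Z] [NormedSpace 𝕜 Z] [CompleteSpace Z]
    [NormedAddCommGroup Y] [NormedSpace 𝕜 Y] [CompleteSpace Y] (q : Z →L[𝕜] Y),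
    Function.Surjective q → ∀ T : E →L[𝕜] Y, ∃ S : E →L[𝕜] Z, q.comp S = T

theorem exists_lp_one_extension {Ω : Type*} [DecidableEq Ω] {Z : Type*} [NormedAddCommGroup Z]
    [NormedSpace 𝕜 Z] [CompleteSpace Z] (z : Ω → Z) {C : ℝ} (hz : ∀ ω, ‖z ω‖ ≤ C) :
    ∃ S : lp (fun _ : Ω => 𝕜) 1 →L[𝕜] Z, ∀ ω c, S (lp.single 1 ω c) = c • z ω := by
  have hasSum_norm (x : lp (fun _ : Ω => 𝕜) 1) : HasSum (fun ω => ‖x ω‖) ‖x‖ := by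
    simpa using lp.hasSum_norm (p := 1) (by simp) x
  have norm_smul_le (x : lp (fun _ : Ω => 𝕜) 1) (ω : Ω) : ‖x ω • z ω‖ ≤ C * ‖x ω‖ := by
    rw [norm_smul, mul_comm]
    exact mul_le_mul_of_nonneg_right (hz ω) (norm_nonneg _)
  have summable_smul (x : lp (fun _ : Ω => 𝕜) 1) : Summable fun ω => x ω • z ω :=
    .of_norm_bounded ((hasSum_norm x).summable.mul_left C) (norm_smul_le x)
  let S : lp (fun _ : Ω => 𝕜) 1 →ₗ[𝕜] Z :=
    { toFun := fun x => ∑' ω, x ω • z ω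
      map_add' := fun x y => by
        simp [add_smul, (summable_smul x).tsum_add (summable_smul y)]
      map_smul' := fun c x => by
        simp [mul_smul, (summable_smul x).tsum_const_smul] }
  refine ⟨S.mkContinuous C fun x =>
    tsum_of_norm_bounded ((hasSum_norm x).mul_left C) (norm_smul_le x), fun ω c => ?_⟩
  refine (tsum_eq_single ω fun ω' h => ?_).trans ?_
  · rw [lp.single_apply_ne _ _ _ h, zero_smul]
  · rw [lp.single_apply_self]

theorem hasLifting_of_equiv_lp_one {E : Type u} [NormedAddCommGroup E] [NormedSpace 𝕜 E]
    {Ω : Type*} (e : E ≃L[𝕜] lp (fun _ : Ω => 𝕜) 1) : HasLifting 𝕜 E := by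
  classical
  intro Z Y _ _ _ _ _ _ q hq T
  obtain ⟨C, hC, hpre⟩ := q.exists_preimage_norm_le hq
  choose p hp hpC using hpre
  let T' : lp (fun _ : Ω => 𝕜) 1 →L[𝕜] Y := T.comp e.symm.toContinuousLinearMap
  obtain ⟨S, hS⟩ := exists_lp_one_extension (𝕜 := 𝕜) (fun ω => p (T' (lp.single 1 ω 1)))
    (C := C * ‖T'‖) fun ω => (hpC _).trans <| mul_le_mul_of_nonneg_left
      (by simpa [lp.norm_single] using T'.le_opNorm (lp.single 1 ω 1)) hC.le
  have hqS (ω : Ω) (c : 𝕜) : q (S (lp.single 1 ω c)) = T' (lp.single 1 ω c) := by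
    rw [hS, map_smul, hp, ← map_smul, ← lp.single_smul, smul_eq_mul, mul_one]
  refine ⟨S.comp e.toContinuousLinearMap, ContinuousLinearMap.ext fun x => ?_⟩
  have hx := lp.hasSum_single (p := 1) (by simp) (e x)
  have hx' : HasSum (fun ω => q (S (lp.single 1 ω (e x ω)))) (T x) := by
    simpa [hqS, T'] using hx.mapL T'
  exact (hx.mapL (q.comp S)).unique hx'

variable {E : Type u} [NormedAddCommGroup E] [NormedSpace 𝕜 E]
  {X : Type u} [NormedAddCommGroup X] [NormedSpace 𝕜 X] [CompleteSpace X]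
  {Y : Type u} [NormedAddCommGroup Y] [NormedSpace 𝕜 Y] [CompleteSpace Y]
  {Z : Type u} [NormedAddCommGroup Z] [NormedSpace 𝕜 Z]

theorem HasLifting.exists_multilinear_lift (hE : HasLifting 𝕜 E) {q : X →L[𝕜] Y}
    (hq : Function.Surjective q) (n : ℕ) (T : E [×n]→L[𝕜] Y) :
    ∃ S : E [×n]→L[𝕜] X, q.compContinuousMultilinearMap S = T := by
  induction n with
  | zero =>
    obtain ⟨x, hx⟩ := hq (T 0)
    refine ⟨ContinuousMultilinearMap.uncurry0 𝕜 E x, ?_⟩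
    ext a
    rw [Subsingleton.elim a 0]
    simpa using hx
  | succ n ih =>
    -- Composition with `q` is onto on `n`-linear maps, so `curryLeft T` lifts as an operator.
    obtain ⟨S, hS⟩ := hE (E [×n]→L[𝕜] X) (E [×n]→L[𝕜] Y)
      (ContinuousLinearMap.compContinuousMultilinearMapL 𝕜 (fun _ : Fin n => E) X Y q) ih
      T.curryLeft
    refine ⟨S.uncurryLeft, ?_⟩
    ext a
    simpa using congrArg (fun f => f (a 0) (Fin.tail a)) hS

theorem HasLifting.exists_multilinear_lift_of_exact (hE : HasLifting 𝕜 E) {d : X →L[𝕜] Y}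
    {d' : Y →L[𝕜] Z} (hd : Function.Exact d d') {n : ℕ} (T : E [×n]→L[𝕜] Y)
    (hT : ∀ a, d' (T a) = 0) : ∃ S : E [×n]→L[𝕜] X, ∀ a, d (S a) = T a := by
  have : CompleteSpace d'.ker := d'.isClosed_ker.completeSpace_coe
  have hsurj : Function.Surjective (d.codRestrict d'.ker hd.apply_apply_eq_zero) := fun k => by
    obtain ⟨x, hx⟩ := (hd k).1 k.2
    exact ⟨x, Subtype.ext hx⟩
  obtain ⟨S, hS⟩ := hE.exists_multilinear_lift hsurj n (T.codRestrict d'.ker hT)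
  exact ⟨S, fun a => congrArg Subtype.val (DFunLike.congr_fun hS a)⟩

end Lifting

/-! ### Operators on chains -/

section ChainMaps

variable {A : Type u} [NormedRing A] [NormedAlgebra ℂ A]
  {M : Type v} [NormedAddCommGroup M] [NormedSpace ℂ M]
  {N : Type w} [NormedAddCommGroup N] [NormedSpace ℂ N]
  {G : Type*} [NormedAddCommGroup G] [NormedSpace ℂ G]

theorem projTensor_hom_ext {E F : Type*} [NormedAddCommGroup E] [NormedSpace ℂ E]
    [NormedAddCommGroup F] [NormedSpace ℂ F] {f g : ProjTensor E F →L[ℂ] G}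
    (h : ∀ x y, f (projMk E F x y) = g (projMk E F x y)) : f = g := by
  have eq_on_alg : (f.comp UniformSpace.Completion.toComplL).toLinearMap
      = (g.comp UniformSpace.Completion.toComplL).toLinearMap :=
    TensorProduct.ext' (M := E) (N := F) h
  ext z
  induction z using UniformSpace.Completion.induction_on with
  | hp => exact isClosed_eq f.continuous g.continuous
  | ih z => exact LinearMap.congr_fun eq_on_alg z

theorem projPower_hom_ext {E : Type*} [NormedAddCommGroup E] [NormedSpace ℂ E] {n : ℕ}
    {f g : ProjPower E n →L[ℂ] G} (h : ∀ a, f (powMk E n a) = g (powMk E n a)) : f = g := by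
  have eq_on_alg : (f.comp UniformSpace.Completion.toComplL).toLinearMap
      = (g.comp UniformSpace.Completion.toComplL).toLinearMap :=
    PiTensorProduct.ext (MultilinearMap.ext h)
  ext z
  induction z using UniformSpace.Completion.induction_on with
  | hp => exact isClosed_eq f.continuous g.continuous
  | ih z => exact LinearMap.congr_fun eq_on_alg z

theorem chain_hom_ext {n : ℕ} {f g : Chain A M n →L[ℂ] G}
    (h : ∀ x a, f (chainMk A M n x a) = g (chainMk A M n x a)) : f = g := by
  refine projTensor_hom_ext fun x y => ?_
  have : f.comp (projMk M (ProjPower A n) x) = g.comp (projMk M (ProjPower A n) x) :=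
    projPower_hom_ext (h x)
  exact DFunLike.congr_fun this y

/-- A homomorphism of bimodules: a bounded linear map commuting with both actions. -/
structure Bimodule.IsHom (B : Bimodule A M) (B' : Bimodule A N) (φ : M →L[ℂ] N) : Prop where
  map_left : ∀ a x, φ (B.left a x) = B'.left a (φ x)
  map_right : ∀ a x, φ (B.right a x) = B'.right a (φ x)

/-- The operator `φ ⊗ id` on chains induced by an operator `φ` on coefficients. -/
def chainMap (n : ℕ) (φ : M →L[ℂ] N) : Chain A M n →L[ℂ] Chain A N n :=
  chainLift ((chainMk A N n).comp φ)

@[simp]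
theorem chainMap_mk (n : ℕ) (φ : M →L[ℂ] N) (x : M) (a : Fin n → A) :
    chainMap n φ (chainMk A M n x a) = chainMk A N n (φ x) a := by
  simp [chainMap]

theorem Bimodule.IsHom.boundary_chainMap {B : Bimodule A M} {B' : Bimodule A N} {φ : M →L[ℂ] N}
    (hφ : B.IsHom B' φ) (n : ℕ) (c : Chain A M (n + 1)) :
    B'.boundary n (chainMap (n + 1) φ c) = chainMap n φ (B.boundary n c) := by
  have : (B'.boundary n).comp (chainMap (n + 1) φ) = (chainMap n φ).comp (B.boundary n) :=
    chain_hom_ext fun x a => by simp [Bimodule.boundary_mk, hφ.map_left, hφ.map_right]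
  exact DFunLike.congr_fun this c

theorem Bimodule.IsHom.coboundary_comp {B : Bimodule A M} {B' : Bimodule A N} {φ : M →L[ℂ] N}
    (hφ : B.IsHom B' φ) (n : ℕ) (F : Cochain A M n) :
    B'.coboundary n (φ.compContinuousMultilinearMap F)
      = φ.compContinuousMultilinearMap (B.coboundary n F) := by
  ext a
  simp [Bimodule.coboundary_apply, hφ.map_left, hφ.map_right]

end ChainMaps

/-! ### The boundary operators form a complex -/

section Complex

theorem sum_alternating_eq_zero {R G : Type*} [Ring R] [AddCommGroup G] [Module R G]
    (g : ℕ → ℕ → G) (n : ℕ) (h : ∀ i j, i ≤ j → j < n → g i (j + 1) = g j i) :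
    ∑ j ∈ Finset.range (n + 1), ∑ i ∈ Finset.range n, (-1 : R) ^ (i + j) • g i j = 0 := by
  induction n with
  | zero => simp
  | succ n ih =>
    have last_row : ∑ i ∈ Finset.range (n + 1), (-1 : R) ^ (i + (n + 1)) • g i (n + 1)
        = -∑ i ∈ Finset.range (n + 1), (-1 : R) ^ (n + i) • g n i := by
      rw [← Finset.sum_neg_distrib]
      refine Finset.sum_congr rfl fun i hi => ?_
      rw [h i n (Nat.lt_succ_iff.1 (Finset.mem_range.1 hi)) n.lt_succ_self, ← neg_smul,
        ← add_assoc, pow_succ, mul_neg_one, add_comm i]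
    have other_rows :
        ∑ j ∈ Finset.range (n + 1), ∑ i ∈ Finset.range (n + 1), (-1 : R) ^ (i + j) • g i j
          = ∑ j ∈ Finset.range (n + 1), (-1 : R) ^ (n + j) • g n j := by
      rw [Finset.sum_congr rfl fun j _ => Finset.sum_range_succ _ n, Finset.sum_add_distrib,
        ih fun i j hij hj => h i j hij (Nat.lt_succ_of_lt hj), zero_add]
    rw [Finset.sum_range_succ, last_row, other_rows, add_neg_cancel]

variable {A : Type u}

/-- The entries `a₁, …, aₙ` left by the `i`-th Hochschild face map; the entry `k : Fin n` is the
`(k + 1)`-st one because position `0` is occupied by the coefficient, see `Bimodule.faceCoeff`. -/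
def faceTuple [Mul A] {n : ℕ} (i : ℕ) (a : Fin (n + 1) → A) : Fin n → A := fun k =>
  if (k : ℕ) + 1 < i then a k.castSucc
  else if (k : ℕ) + 1 = i then a k.castSucc * a k.succ else a k.succ

theorem faceTuple_comm [Semigroup A] {n i j : ℕ} (hij : i ≤ j) (a : Fin (n + 2) → A) :
    faceTuple i (faceTuple (j + 1) a) = faceTuple j (faceTuple i a) := by
  ext k
  simp only [faceTuple, Fin.val_castSucc, Fin.val_succ]
  split_ifs <;> first | omega | rfl | exact mul_assoc _ _ _ | exact (mul_assoc _ _ _).symm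

variable [NormedRing A] [NormedAlgebra ℂ A]
  {M : Type v} [NormedAddCommGroup M] [NormedSpace ℂ M] (B : Bimodule A M)

/-- The coefficient left by the `i`-th Hochschild face map: only the extreme faces act on it. -/
def Bimodule.faceCoeff {n : ℕ} (i : ℕ) (x : M) (a : Fin (n + 1) → A) : M :=
  if i = 0 then B.right (a 0) x else if i = n + 1 then B.left (a (Fin.last n)) x else x

theorem Bimodule.faceCoeff_comm {n i j : ℕ} (hij : i ≤ j) (hj : j < n + 2) (x : M)
    (a : Fin (n + 2) → A) :
    B.faceCoeff i (B.faceCoeff (j + 1) x a) (faceTuple (j + 1) a)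
      = B.faceCoeff j (B.faceCoeff i x a) (faceTuple i a) := by
  rcases Nat.eq_zero_or_pos i with rfl | hi
  · rcases Nat.eq_zero_or_pos j with rfl | hj₀
    · simp [faceCoeff, faceTuple, B.right_mul]
    · rcases eq_or_ne j (n + 1) with rfl | hj₁
      · simp [faceCoeff, faceTuple, B.left_right]
      · simp [faceCoeff, faceTuple, hj₀, hj₀.ne', hj₁]
  · rcases eq_or_ne j (n + 1) with rfl | hj₁
    · rcases eq_or_ne i (n + 1) with rfl | hi₁
      · simp [faceCoeff, faceTuple, B.left_mul]
      · have hlt : ¬ n + 1 < i := by omega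
        have hne : i ≠ n + 2 := by omega
        simp [faceCoeff, faceTuple, hi.ne', hi₁, hi₁.symm, hlt, hne]
    · have hi₁ : i ≠ n + 1 := by omega
      have hi₂ : i ≠ n + 2 := by omega
      have hj₀ : j ≠ 0 := by omega
      simp [faceCoeff, hi.ne', hj₁, hi₁, hi₂, hj₀]

theorem Bimodule.boundary_mk_eq_sum (n : ℕ) (x : M) (a : Fin (n + 1) → A) :
    B.boundary n (chainMk A M (n + 1) x a) = ∑ i ∈ Finset.range (n + 2),
      (-1 : ℂ) ^ i • chainMk A M n (B.faceCoeff i x a) (faceTuple i a) := by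
  have faceTuple_zero : faceTuple 0 a = Fin.tail a := by ext k; simp [faceTuple, Fin.tail]
  have faceTuple_last : faceTuple (n + 1) a = Fin.init a := by ext k; simp [faceTuple, Fin.init]
  have faceTuple_inner (j : Fin n) : faceTuple (j + 1) a = mulAt j a := by
    ext k
    simp [faceTuple, mulAt, Fin.contractNth]
  have faceCoeff_inner (j : Fin n) : B.faceCoeff (j + 1) x a = x := by
    simp [faceCoeff, j.isLt.ne]
  rw [B.boundary_mk, Finset.sum_range_succ, Finset.sum_range_succ', Finset.sum_range]
  simp only [faceTuple_zero, faceTuple_last, faceTuple_inner, faceCoeff_inner]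
  simp [faceCoeff, add_comm]

theorem Bimodule.boundary_boundary (n : ℕ) (c : Chain A M (n + 2)) :
    B.boundary n (B.boundary (n + 1) c) = 0 := by
  have : (B.boundary n).comp (B.boundary (n + 1)) = 0 := chain_hom_ext fun x a => by
    have cancel := sum_alternating_eq_zero (R := ℂ) (fun i j => chainMk A M n
      (B.faceCoeff i (B.faceCoeff j x a) (faceTuple j a)) (faceTuple i (faceTuple j a))) (n + 2)
      fun i j hij hj => by rw [B.faceCoeff_comm hij hj, faceTuple_comm hij]
    rw [ContinuousLinearMap.comp_apply, B.boundary_mk_eq_sum, map_sum]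
    simp only [map_smul, B.boundary_mk_eq_sum, Finset.smul_sum, smul_smul, ← pow_add]
    refine Eq.trans ?_ cancel
    exact Finset.sum_congr rfl fun j _ => Finset.sum_congr rfl fun i _ => by rw [add_comm]
  exact DFunLike.congr_fun this c

end Complex

/-! ### Vanishing of homology and cohomology -/

section Vanishing

variable {A : Type u} [NormedRing A] [NormedAlgebra ℂ A]
  {M : Type v} [NormedAddCommGroup M] [NormedSpace ℂ M] (B : Bimodule A M)

theorem Bimodule.subsingleton_homology_succ_iff (n : ℕ) :
    Subsingleton (B.Homology (n + 1)) ↔ Function.Exact (B.boundary (n + 1)) (B.boundary n) := by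
  rw [Submodule.Quotient.subsingleton_iff, Submodule.submoduleOf, Submodule.comap_subtype_eq_top]
  refine ⟨fun h c => ⟨fun hc => h hc, ?_⟩, fun h c hc => (h c).1 hc⟩
  rintro ⟨b, rfl⟩
  exact B.boundary_boundary n b

theorem Bimodule.subsingleton_cohomology_succ_iff (n : ℕ) :
    Subsingleton (B.Cohomology (n + 1)) ↔
      ∀ F, B.coboundary (n + 1) F = 0 → ∃ G, B.coboundary n G = F := by
  rw [Submodule.Quotient.subsingleton_iff, Submodule.submoduleOf, Submodule.comap_subtype_eq_top]
  rfl

theorem Bimodule.subsingleton_homology_of_homotopy {n : ℕ}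
    {s : Chain A M n →L[ℂ] Chain A M (n + 1)} {s' : Chain A M (n + 1) →L[ℂ] Chain A M (n + 2)}
    (h : s.comp (B.boundary n) + (B.boundary (n + 1)).comp s' = ContinuousLinearMap.id ℂ _) :
    Subsingleton (B.Homology (n + 1)) := by
  refine (B.subsingleton_homology_succ_iff n).2 fun c => ⟨fun hc => ⟨s' c, ?_⟩, ?_⟩
  · simpa [hc] using DFunLike.congr_fun h c
  · rintro ⟨b, rfl⟩
    exact B.boundary_boundary n b

theorem forall_one_le_iff_forall_succ {p : ℕ → Prop} : (∀ n, 1 ≤ n → p n) ↔ ∀ n, p (n + 1) :=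
  ⟨fun h n => h _ n.succ_pos, fun h n hn => Nat.succ_pred_eq_of_pos hn ▸ h n.pred⟩

end Vanishing

/-! ### Cochains with values in a dual bimodule -/

section DualCochains

variable {A : Type u} [NormedRing A] [NormedAlgebra ℂ A]
  {M : Type v} [NormedAddCommGroup M] [NormedSpace ℂ M] {n : ℕ}

/-- The identification of cochains `F` with values in `M'` with functionals on chains, given by
`x ⊗ a₁ ⊗ ⋯ ⊗ aₙ ↦ F(a₁, …, aₙ)(x)`. -/
def dualCochainEquiv (A : Type u) [NormedRing A] [NormedAlgebra ℂ A] (M : Type v)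
    [NormedAddCommGroup M] [NormedSpace ℂ M] (n : ℕ) :
    Cochain A (StrongDual ℂ M) n ≃ StrongDual ℂ (Chain A M n) where
  toFun F := chainLift F.flipLinear
  invFun φ := ((ContinuousLinearMap.compContinuousMultilinearMapL ℂ (fun _ : Fin n => A)
    (Chain A M n) ℂ φ).comp (chainMk A M n)).flipMultilinear
  left_inv F := by
    ext a x
    exact chainLift_mk _ _ _
  right_inv φ := chain_hom_ext fun x a => chainLift_mk _ _ _

@[simp]
theorem dualCochainEquiv_mk (F : Cochain A (StrongDual ℂ M) n) (x : M) (a : Fin n → A) :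
    dualCochainEquiv A M n F (chainMk A M n x a) = F a x :=
  chainLift_mk _ _ _

theorem dualCochainEquiv_coboundary (B : Bimodule A M) (F : Cochain A (StrongDual ℂ M) n) :
    dualCochainEquiv A M (n + 1) (B.dual.coboundary n F)
      = dualMap (B.boundary n) (dualCochainEquiv A M n F) :=
  chain_hom_ext fun x a => by simp [B.boundary_mk, B.dual.coboundary_apply]

theorem Bimodule.exact_dualMap_boundary (B : Bimodule A M)
    (h : Subsingleton (B.dual.Cohomology (n + 1))) :
    Function.Exact (dualMap (B.boundary n)) (dualMap (B.boundary (n + 1))) := by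
  refine fun φ => ⟨fun hφ => ?_, ?_⟩
  · obtain ⟨F, rfl⟩ := (dualCochainEquiv A M (n + 1)).surjective φ
    have hF : B.dual.coboundary (n + 1) F = 0 :=
      (dualCochainEquiv A M (n + 2)).injective <| by
        rw [dualCochainEquiv_coboundary, hφ]
        exact chain_hom_ext fun x a => by simp
    obtain ⟨G, rfl⟩ := (B.dual.subsingleton_cohomology_succ_iff n).1 h F hF
    exact ⟨_, (dualCochainEquiv_coboundary B G).symm⟩
  · rintro ⟨ψ, rfl⟩
    ext c
    simp [B.boundary_boundary]

theorem Bimodule.subsingleton_homology_of_dual (B : Bimodule A M)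
    (h₁ : Subsingleton (B.dual.Cohomology (n + 1)))
    (h₂ : Subsingleton (B.dual.Cohomology (n + 2))) : Subsingleton (B.Homology (n + 1)) :=
  (B.subsingleton_homology_succ_iff n).2 <|
    exact_of_dual_exact (B.exact_dualMap_boundary h₁) (B.exact_dualMap_boundary h₂)

end DualCochains

/-! ### Retracts and isomorphic bimodules -/

section Transport

variable {A : Type u} [NormedRing A] [NormedAlgebra ℂ A]
  {M : Type v} [NormedAddCommGroup M] [NormedSpace ℂ M]
  {N : Type w} [NormedAddCommGroup N] [NormedSpace ℂ N]
  {B : Bimodule A M} {B' : Bimodule A N} {i : M →L[ℂ] N} {p : N →L[ℂ] M} {n : ℕ}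

theorem Bimodule.IsHom.subsingleton_homology_of_leftInverse (hi : B.IsHom B' i)
    (hp : B'.IsHom B p) (h : Function.LeftInverse p i)
    (hB' : Subsingleton (B'.Homology (n + 1))) : Subsingleton (B.Homology (n + 1)) := by
  rw [Bimodule.subsingleton_homology_succ_iff] at hB' ⊢
  have retract (c : Chain A M (n + 1)) : chainMap (n + 1) p (chainMap (n + 1) i c) = c :=
    DFunLike.congr_fun (f := (chainMap (n + 1) p).comp (chainMap (n + 1) i))
      (g := ContinuousLinearMap.id ℂ _) (chain_hom_ext fun x a => by simp [h x]) c
  refine fun c => ⟨fun hc => ?_, ?_⟩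
  · obtain ⟨b, hb⟩ := (hB' (chainMap (n + 1) i c)).1 (by rw [hi.boundary_chainMap, hc, map_zero])
    exact ⟨chainMap (n + 2) p b, by rw [hp.boundary_chainMap, hb, retract]⟩
  · rintro ⟨b, rfl⟩
    exact B.boundary_boundary n b

theorem Bimodule.IsHom.subsingleton_cohomology_of_leftInverse (hi : B.IsHom B' i)
    (hp : B'.IsHom B p) (h : Function.LeftInverse p i)
    (hB' : Subsingleton (B'.Cohomology (n + 1))) : Subsingleton (B.Cohomology (n + 1)) := by
  rw [Bimodule.subsingleton_cohomology_succ_iff] at hB' ⊢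
  intro F hF
  obtain ⟨G, hG⟩ := hB' (i.compContinuousMultilinearMap F) (by
    rw [hi.coboundary_comp, hF]; ext; simp)
  refine ⟨p.compContinuousMultilinearMap G, ?_⟩
  rw [hp.coboundary_comp, hG]
  ext a
  exact h (F a)

variable (B) (φ : N ≃L[ℂ] M)

/-- The bimodule structure on `N` carried over from `M` along a linear homeomorphism. -/
def Bimodule.transport : Bimodule A N where
  left := ((φ.symm.toContinuousLinearMap.postcomp N).comp
    (φ.toContinuousLinearMap.precomp M)).comp B.left
  right := ((φ.symm.toContinuousLinearMap.postcomp N).comp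
    (φ.toContinuousLinearMap.precomp M)).comp B.right
  left_mul a b x := by simp [B.left_mul]
  right_mul a b x := by simp [B.right_mul]
  left_right a b x := by simp [B.left_right]

@[simp]
theorem Bimodule.transport_left (a : A) (x : N) :
    (B.transport φ).left a x = φ.symm (B.left a (φ x)) := rfl

@[simp]
theorem Bimodule.transport_right (a : A) (x : N) :
    (B.transport φ).right a x = φ.symm (B.right a (φ x)) := rfl

theorem Bimodule.isHom_transport : (B.transport φ).IsHom B φ.toContinuousLinearMap where
  map_left a x := by simp
  map_right a x := by simp

theorem Bimodule.isHom_transport_symm : B.IsHom (B.transport φ) φ.symm.toContinuousLinearMap where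
  map_left a x := by simp
  map_right a x := by simp

variable {B}

theorem Bimodule.IsSymmetric.transport (h : B.IsSymmetric) : (B.transport φ).IsSymmetric :=
  fun a x => by simp [h a]

theorem Bimodule.IsUnitLinked.transport (h : B.IsUnitLinked) : (B.transport φ).IsUnitLinked :=
  fun x => by simp [(h (φ x)).1, (h (φ x)).2]

variable (B)

theorem Bimodule.subsingleton_homology_of_transport
    (h : Subsingleton ((B.transport φ).Homology (n + 1))) : Subsingleton (B.Homology (n + 1)) :=
  (B.isHom_transport_symm φ).subsingleton_homology_of_leftInverse (B.isHom_transport φ)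
    φ.apply_symm_apply h

theorem Bimodule.subsingleton_cohomology_of_transport
    (h : Subsingleton ((B.transport φ).Cohomology (n + 1))) :
    Subsingleton (B.Cohomology (n + 1)) :=
  (B.isHom_transport_symm φ).subsingleton_cohomology_of_leftInverse (B.isHom_transport φ)
    φ.apply_symm_apply h

end Transport

/-! ### Base change from `A` to symmetric bimodules -/

section BaseChange

open Bimodule (regular)

variable {A : Type u} [NormedRing A] [NormedAlgebra ℂ A]
  {M : Type v} [NormedAddCommGroup M] [NormedSpace ℂ M] {B : Bimodule A M} {k m n : ℕ}

theorem regular_left_apply (a b : A) : (regular A).left a b = a * b := rfl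

theorem regular_right_apply (a b : A) : (regular A).right a b = b * a := rfl

theorem regular_isUnitLinked : (regular A).IsUnitLinked := fun a => ⟨one_mul a, mul_one a⟩

theorem Bimodule.IsUnitLinked.dual (h : B.IsUnitLinked) : B.dual.IsUnitLinked :=
  fun φ => ⟨by ext x; simp [(h x).2], by ext x; simp [(h x).1]⟩

theorem Bimodule.IsSymmetric.dual (h : B.IsSymmetric) : B.dual.IsSymmetric :=
  fun a φ => by ext x; simp [h a]

theorem Bimodule.IsSymmetric.left_comm (h : B.IsSymmetric) (a b : A) (x : M) :
    B.left a (B.left b x) = B.left b (B.left a x) := by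
  rw [h b x, B.left_right, ← h b]

theorem Bimodule.IsSymmetric.boundary_zero (h : B.IsSymmetric) : B.boundary 0 = 0 :=
  chain_hom_ext fun x a => by
    have : Fin.tail a = Fin.init a := Subsingleton.elim _ _
    simp [B.boundary_mk, h _ x, this]

/-- `A`-linearity of operators between chain spaces of `A`, for the action on the coefficient. -/
def IsModuleMap (s : Chain A A m →L[ℂ] Chain A A k) : Prop :=
  ∀ a c, s ((regular A).chainAct m a c) = (regular A).chainAct k a (s c)

theorem chainAct_mk_one (b : A) (a : Fin n → A) :
    (regular A).chainAct n b (chainMk A A n 1 a) = chainMk A A n b a := by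
  simp [regular_left_apply]

variable (B)

/-- The bilinear map `(a₀ ⊗ a₁ ⊗ ⋯ ⊗ aₙ, x) ↦ a₀ x ⊗ a₁ ⊗ ⋯ ⊗ aₙ`, which identifies the chains with
coefficients in `M` with the base change of the chains of `A`. -/
def Bimodule.coeffAct (n : ℕ) : Chain A A n →L[ℂ] M →L[ℂ] Chain A M n :=
  chainLift (((ContinuousLinearMap.flipMultilinearEquiv ℂ (fun _ : Fin n => A) M
    (Chain A M n)).toContinuousLinearMap).comp (((chainMk A M n).postcomp M).comp B.left))

@[simp]
theorem Bimodule.coeffAct_mk (a₀ : A) (a : Fin n → A) (x : M) :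
    B.coeffAct n (chainMk A A n a₀ a) x = chainMk A M n (B.left a₀ x) a := by
  rw [coeffAct, chainLift_mk]
  rfl

/-- The operator `x ⊗ a₁ ⊗ ⋯ ⊗ aₘ ↦ g(a₁, …, aₘ) x` induced by a multilinear map `g` with values in
the `k`-chains of `A`. -/
def Bimodule.extend (g : A [×m]→L[ℂ] Chain A A k) : Chain A M m →L[ℂ] Chain A M k :=
  chainLift (((B.coeffAct k).compContinuousMultilinearMap g).flipLinear)

@[simp]
theorem Bimodule.extend_mk (g : A [×m]→L[ℂ] Chain A A k) (x : M) (a : Fin m → A) :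
    B.extend g (chainMk A M m x a) = B.coeffAct k (g a) x := by
  simp [extend]

/-- The base change `M ⊗_A s` of an operator `s` between chain spaces of `A`. Only the values of `s`
on the tensors `1 ⊗ a₁ ⊗ ⋯ ⊗ aₘ` enter, so this is meaningful when `s` is a module map. -/
def Bimodule.baseChange (s : Chain A A m →L[ℂ] Chain A A k) : Chain A M m →L[ℂ] Chain A M k :=
  B.extend (s.compContinuousMultilinearMap (chainMk A A m 1))

theorem Bimodule.baseChange_mk (s : Chain A A m →L[ℂ] Chain A A k) (x : M) (a : Fin m → A) :
    B.baseChange s (chainMk A M m x a) = B.coeffAct k (s (chainMk A A m 1 a)) x := by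
  simp [baseChange]

theorem Bimodule.baseChange_add (s t : Chain A A m →L[ℂ] Chain A A k) :
    B.baseChange (s + t) = B.baseChange s + B.baseChange t :=
  chain_hom_ext fun x a => by simp [baseChange_mk]

variable {B}

theorem Bimodule.IsUnitLinked.baseChange_id (h : B.IsUnitLinked) :
    B.baseChange (ContinuousLinearMap.id ℂ (Chain A A n)) = ContinuousLinearMap.id ℂ _ :=
  chain_hom_ext fun x a => by simp [baseChange_mk, (h x).1]

theorem Bimodule.IsSymmetric.coeffAct_chainAct (h : B.IsSymmetric) (b : A) (c : Chain A A n)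
    (x : M) : B.coeffAct n ((regular A).chainAct n b c) x = B.coeffAct n c (B.left b x) := by
  have : ((B.coeffAct n).flip x).comp ((regular A).chainAct n b)
      = (B.coeffAct n).flip (B.left b x) :=
    chain_hom_ext fun a₀ a => by
      simp [regular_left_apply, B.left_mul, h.left_comm b]
  exact DFunLike.congr_fun this c

theorem Bimodule.IsSymmetric.boundary_coeffAct (h : B.IsSymmetric) (c : Chain A A (n + 1)) (x : M) :
    B.boundary n (B.coeffAct (n + 1) c x) = B.coeffAct n ((regular A).boundary n c) x := by
  have : (B.boundary n).comp ((B.coeffAct (n + 1)).flip x)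
      = ((B.coeffAct n).flip x).comp ((regular A).boundary n) :=
    chain_hom_ext fun a₀ a => by
      simp [boundary_mk, regular_left_apply, regular_right_apply, B.left_mul, ← B.left_right,
        ← h _ x]
  exact DFunLike.congr_fun this c

theorem Bimodule.IsSymmetric.baseChange_coeffAct (h : B.IsSymmetric)
    {s : Chain A A m →L[ℂ] Chain A A k} (hs : IsModuleMap s) (c : Chain A A m) (x : M) :
    B.baseChange s (B.coeffAct m c x) = B.coeffAct k (s c) x := by
  have : (B.baseChange s).comp ((B.coeffAct m).flip x) = ((B.coeffAct k).flip x).comp s :=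
    chain_hom_ext fun a₀ a => by
      simp [baseChange_mk, ← h.coeffAct_chainAct, ← hs a₀, regular_left_apply]
  exact DFunLike.congr_fun this c

theorem Bimodule.IsSymmetric.baseChange_comp (h : B.IsSymmetric)
    {s : Chain A A m →L[ℂ] Chain A A k} (hs : IsModuleMap s) (t : Chain A A n →L[ℂ] Chain A A m) :
    B.baseChange (s.comp t) = (B.baseChange s).comp (B.baseChange t) :=
  chain_hom_ext fun x a => by simp [baseChange_mk, h.baseChange_coeffAct hs]

theorem Bimodule.IsSymmetric.baseChange_boundary (h : B.IsSymmetric) (h₁ : B.IsUnitLinked) :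
    B.baseChange ((regular A).boundary n) = B.boundary n :=
  chain_hom_ext fun x a => by simp [baseChange_mk, ← h.boundary_coeffAct, (h₁ x).1]

end BaseChange

/-! ### Pullback of cochains -/

section Pullback

open Bimodule (regular)

variable {A : Type u} [NormedRing A] [NormedAlgebra ℂ A]
  {M : Type v} [NormedAddCommGroup M] [NormedSpace ℂ M] [CompleteSpace M]
  (B : Bimodule A M) {k m n : ℕ}

/-- The module map `a₀ ⊗ a₁ ⊗ ⋯ ⊗ aₙ ↦ a₀ F(a₁, …, aₙ)` associated with a cochain `F`. -/
def Bimodule.cochainExtend (F : Cochain A M n) : Chain A A n →L[ℂ] M :=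
  chainLift ((B.left.flip.compContinuousMultilinearMap F).flipLinear)

@[simp]
theorem Bimodule.cochainExtend_mk (F : Cochain A M n) (a₀ : A) (a : Fin n → A) :
    B.cochainExtend F (chainMk A A n a₀ a) = B.left a₀ (F a) := by
  simp [cochainExtend]

theorem Bimodule.cochainExtend_chainAct (F : Cochain A M n) (b : A) (c : Chain A A n) :
    B.cochainExtend F ((regular A).chainAct n b c) = B.left b (B.cochainExtend F c) := by
  have : (B.cochainExtend F).comp ((regular A).chainAct n b)
      = (B.left b).comp (B.cochainExtend F) :=
    chain_hom_ext fun a₀ a => by simp [regular_left_apply, B.left_mul]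
  exact DFunLike.congr_fun this c

/-- The pullback `Hom_A(s, M)` of cochains along an operator `s` between chain spaces of `A`, under
the identification of a cochain `F` with `B.cochainExtend F`. -/
def Bimodule.pullback (s : Chain A A m →L[ℂ] Chain A A k) (F : Cochain A M k) : Cochain A M m :=
  ((B.cochainExtend F).comp s).compContinuousMultilinearMap (chainMk A A m 1)

theorem Bimodule.pullback_apply (s : Chain A A m →L[ℂ] Chain A A k) (F : Cochain A M k)
    (a : Fin m → A) : B.pullback s F a = B.cochainExtend F (s (chainMk A A m 1 a)) := rfl

theorem Bimodule.pullback_zero (s : Chain A A m →L[ℂ] Chain A A k) : B.pullback s 0 = 0 := by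
  have : B.cochainExtend (0 : Cochain A M k) = 0 := chain_hom_ext fun a₀ a => by simp
  ext a
  simp [pullback_apply, this]

theorem Bimodule.pullback_add (s t : Chain A A m →L[ℂ] Chain A A k) (F : Cochain A M k) :
    B.pullback (s + t) F = B.pullback s F + B.pullback t F := by
  ext a
  simp [pullback_apply]

theorem Bimodule.cochainExtend_pullback {s : Chain A A m →L[ℂ] Chain A A k} (hs : IsModuleMap s)
    (F : Cochain A M k) : B.cochainExtend (B.pullback s F) = (B.cochainExtend F).comp s :=
  chain_hom_ext fun a₀ a => by
    rw [cochainExtend_mk, pullback_apply, ← cochainExtend_chainAct, ← hs, chainAct_mk_one,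
      ContinuousLinearMap.comp_apply]

theorem Bimodule.pullback_comp {s : Chain A A m →L[ℂ] Chain A A k} (hs : IsModuleMap s)
    (t : Chain A A n →L[ℂ] Chain A A m) (F : Cochain A M k) :
    B.pullback (s.comp t) F = B.pullback t (B.pullback s F) := by
  ext a
  simp [pullback_apply, B.cochainExtend_pullback hs]

variable {B}

theorem Bimodule.IsUnitLinked.pullback_id (h : B.IsUnitLinked) (F : Cochain A M n) :
    B.pullback (ContinuousLinearMap.id ℂ _) F = F := by
  ext a
  simp [pullback_apply, (h _).1]

theorem Bimodule.IsSymmetric.cochainExtend_boundary (h : B.IsSymmetric) (F : Cochain A M n)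
    (c : Chain A A (n + 1)) :
    B.cochainExtend F ((regular A).boundary n c) = B.cochainExtend (B.coboundary n F) c := by
  have : (B.cochainExtend F).comp ((regular A).boundary n) = B.cochainExtend (B.coboundary n F) :=
    chain_hom_ext fun a₀ a => by
      simp [boundary_mk, coboundary_apply, regular_left_apply, regular_right_apply, B.left_mul,
        ← h _ (F _), h.left_comm a₀ (a (Fin.last n))]
  exact DFunLike.congr_fun this c

theorem Bimodule.IsSymmetric.pullback_boundary (h : B.IsSymmetric) (h₁ : B.IsUnitLinked)
    (F : Cochain A M n) : B.pullback ((regular A).boundary n) F = B.coboundary n F := by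
  ext a
  rw [pullback_apply, h.cochainExtend_boundary, cochainExtend_mk, (h₁ _).1]

end Pullback

/-! ### Consequences of a splitting -/

section Splitting

open Bimodule (regular)

variable {A : Type u} [NormedCommRing A] [NormedAlgebra ℂ A]

theorem regular_isSymmetric : (regular A).IsSymmetric := mul_comm

theorem isModuleMap_boundary (n : ℕ) : IsModuleMap ((regular A).boundary n) := fun b c => by
  have : ((regular A).boundary n).comp ((regular A).chainAct (n + 1) b)
      = ((regular A).chainAct n b).comp ((regular A).boundary n) :=
    chain_hom_ext fun a₀ a => by
      simp [Bimodule.boundary_mk, regular_left_apply, regular_right_apply, mul_assoc,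
        mul_left_comm b]
  exact DFunLike.congr_fun this c

theorem subsingleton_homology_of_splitsAsBanachSpaces
    (h : SplitsAsBanachSpaces (X := fun n => Chain A A (n + 1)) (truncatedBoundary A)) (n : ℕ) :
    Subsingleton (SimplicialHomology A (n + 1)) := by
  obtain ⟨s, hs⟩ := h
  cases n with
  | zero =>
    refine (regular A).subsingleton_homology_of_homotopy (s := 0) (s' := s 0) ?_
    rw [ContinuousLinearMap.zero_comp]
    exact (zero_add (((regular A).boundary 1).comp (s 0))).trans hs.zero
  | succ n => exact (regular A).subsingleton_homology_of_homotopy (hs.succ n)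

-- Since `∂₀ = 0`, a homotopy may be started with the zero map in degree `0`.
theorem splitsAsBanachModules_iff :
    SplitsAsBanachModules (X := fun n => Chain A A (n + 1)) (truncatedAct A) (truncatedBoundary A) ↔
      ∃ s : ∀ n, Chain A A n →L[ℂ] Chain A A (n + 1), (∀ n, IsModuleMap (s n)) ∧
        ∀ n, (s n).comp ((regular A).boundary n) + ((regular A).boundary (n + 1)).comp (s (n + 1))
          = ContinuousLinearMap.id ℂ _ := by
  constructor
  · rintro ⟨s, hs, hact⟩
    refine ⟨fun | 0 => 0 | n + 1 => s n, ?_, ?_⟩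
    · rintro (_ | n)
      · intro a c
        simp
      · exact hact n
    · rintro (_ | n)
      · rw [ContinuousLinearMap.zero_comp]
        exact (zero_add (((regular A).boundary 1).comp (s 0))).trans hs.zero
      · exact hs.succ n
  · rintro ⟨s, hact, hs⟩
    refine ⟨fun n => s (n + 1), ⟨?_, fun n => hs (n + 1)⟩, fun n => hact (n + 1)⟩
    have hs₀ := hs 0
    rw [regular_isSymmetric.boundary_zero, ContinuousLinearMap.comp_zero] at hs₀
    exact (zero_add (((regular A).boundary 1).comp (s 1))).symm.trans hs₀

variable {M : Type v} [NormedAddCommGroup M] [NormedSpace ℂ M] {B : Bimodule A M} {n : ℕ}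
  {s : Chain A A n →L[ℂ] Chain A A (n + 1)} {s' : Chain A A (n + 1) →L[ℂ] Chain A A (n + 2)}

theorem Bimodule.IsSymmetric.subsingleton_homology_of_homotopy (hB : B.IsSymmetric)
    (hB₁ : B.IsUnitLinked) (hs : IsModuleMap s)
    (h : s.comp ((regular A).boundary n) + ((regular A).boundary (n + 1)).comp s'
      = ContinuousLinearMap.id ℂ _) : Subsingleton (B.Homology (n + 1)) := by
  refine B.subsingleton_homology_of_homotopy (s := B.baseChange s) (s' := B.baseChange s') ?_
  rw [← hB.baseChange_boundary hB₁, ← hB.baseChange_boundary hB₁, ← hB.baseChange_comp hs,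
    ← hB.baseChange_comp (isModuleMap_boundary _), ← B.baseChange_add, h, hB₁.baseChange_id]

theorem Bimodule.IsSymmetric.subsingleton_cohomology_of_homotopy [CompleteSpace M]
    (hB : B.IsSymmetric) (hB₁ : B.IsUnitLinked) (hs : IsModuleMap s)
    (h : s.comp ((regular A).boundary n) + ((regular A).boundary (n + 1)).comp s'
      = ContinuousLinearMap.id ℂ _) : Subsingleton (B.Cohomology (n + 1)) := by
  refine (B.subsingleton_cohomology_succ_iff n).2 fun F hF => ⟨B.pullback s F, ?_⟩
  calc B.coboundary n (B.pullback s F)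
      = B.pullback (s.comp ((regular A).boundary n)) F := by
        rw [← hB.pullback_boundary hB₁, B.pullback_comp hs]
    _ = B.pullback (s.comp ((regular A).boundary n)
          + ((regular A).boundary (n + 1)).comp s') F := by
        rw [B.pullback_add, B.pullback_comp (isModuleMap_boundary _), hB.pullback_boundary hB₁,
          hF, B.pullback_zero, add_zero]
    _ = F := by rw [h, hB₁.pullback_id]

end Splitting

/-! ### Construction of a splitting -/

section Construction

open Bimodule (regular)

theorem exists_seq_of_forall_exists {α : ℕ → Type*} {p : ∀ n, α n → Prop}
    {r : ∀ n, α n → α (n + 1) → Prop} {a : α 0} (ha : p 0 a)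
    (h : ∀ n a, p n a → ∃ b, p (n + 1) b ∧ r n a b) :
    ∃ f : ∀ n, α n, ∀ n, p n (f n) ∧ r n (f n) (f (n + 1)) := by
  choose next hp hr using h
  let f : ∀ n, {a : α n // p n a} :=
    Nat.rec ⟨a, ha⟩ fun n a => ⟨next n a a.2, hp n a a.2⟩
  exact ⟨fun n => (f n).1, fun n => ⟨(f n).2, hr n (f n).1 (f n).2⟩⟩

variable {A : Type u} [NormedCommRing A] [NormedAlgebra ℂ A] {k m n : ℕ}

theorem regular_coeffAct (c : Chain A A n) (b : A) :
    (regular A).coeffAct n c b = (regular A).chainAct n b c := by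
  have : ((regular A).coeffAct n).flip b = (regular A).chainAct n b :=
    chain_hom_ext fun a₀ a => by simp [regular_left_apply, mul_comm]
  exact DFunLike.congr_fun this c

theorem isModuleMap_extend (g : A [×m]→L[ℂ] Chain A A k) : IsModuleMap ((regular A).extend g) :=
  fun b c => by
  have : ((regular A).extend g).comp ((regular A).chainAct m b)
      = ((regular A).chainAct k b).comp ((regular A).extend g) :=
    chain_hom_ext fun a₀ a => by
      calc (regular A).extend g ((regular A).chainAct m b (chainMk A A m a₀ a))
          = (regular A).coeffAct k (g a) (a₀ * b) := by
            rw [Bimodule.chainAct_mk, Bimodule.extend_mk, regular_left_apply, mul_comm]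
        _ = (regular A).chainAct k b ((regular A).extend g (chainMk A A m a₀ a)) := by
            rw [Bimodule.extend_mk, ← regular_coeffAct _ b, regular_coeffAct _ a₀,
              regular_isSymmetric.coeffAct_chainAct, regular_left_apply]
  exact DFunLike.congr_fun this c

/-- The chains of `A` are free over `A` on the tensor powers of `A`, which inherit the lifting
property. -/
theorem HasLifting.exists_module_lift (hA : HasLifting ℂ A)
    (hexact : Subsingleton (SimplicialHomology A (n + 1)))
    {T : Chain A A m →L[ℂ] Chain A A (n + 1)} (hT : IsModuleMap T)
    (hdT : ((regular A).boundary n).comp T = 0) :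
    ∃ s, IsModuleMap s ∧ ((regular A).boundary (n + 1)).comp s = T := by
  obtain ⟨g, hg⟩ := hA.exists_multilinear_lift_of_exact
    (((regular A).subsingleton_homology_succ_iff n).1 hexact)
    (T.compContinuousMultilinearMap (chainMk A A m 1)) fun a => DFunLike.congr_fun hdT _
  refine ⟨(regular A).extend g, isModuleMap_extend g, chain_hom_ext fun b a => ?_⟩
  calc (regular A).boundary (n + 1) ((regular A).extend g (chainMk A A m b a))
      = (regular A).chainAct (n + 1) b ((regular A).boundary (n + 1) (g a)) := by
        rw [Bimodule.extend_mk, regular_coeffAct, isModuleMap_boundary]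
    _ = (regular A).chainAct (n + 1) b (T (chainMk A A m 1 a)) := by rw [hg]; rfl
    _ = T (chainMk A A m b a) := by rw [← hT, chainAct_mk_one]

theorem HasLifting.exists_homotopy_succ (hA : HasLifting ℂ A)
    (hexact : Subsingleton (SimplicialHomology A (n + 1)))
    {s : Chain A A n →L[ℂ] Chain A A (n + 1)} (hs : IsModuleMap s)
    (hds : ∀ c, (regular A).boundary n (s ((regular A).boundary n c)) = (regular A).boundary n c) :
    ∃ s', IsModuleMap s' ∧ s.comp ((regular A).boundary n)
      + ((regular A).boundary (n + 1)).comp s' = ContinuousLinearMap.id ℂ _ := by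
  obtain ⟨s', hs', hds'⟩ := hA.exists_module_lift hexact
    (T := ContinuousLinearMap.id ℂ _ - s.comp ((regular A).boundary n))
    (fun a c => by simp [isModuleMap_boundary n a c, hs a _])
    (ContinuousLinearMap.ext fun c => by simp [hds])
  exact ⟨s', hs', by rw [hds', add_sub_cancel]⟩

theorem HasLifting.splitsAsBanachModules (hA : HasLifting ℂ A)
    (h : ∀ n, Subsingleton (SimplicialHomology A (n + 1))) :
    SplitsAsBanachModules (X := fun n => Chain A A (n + 1)) (truncatedAct A)
      (truncatedBoundary A) := by
  -- The condition `∂ₙ sₙ ∂ₙ = ∂ₙ` is what the next step of the recursion needs.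
  let p (n : ℕ) (s : Chain A A n →L[ℂ] Chain A A (n + 1)) : Prop := IsModuleMap s ∧
    ∀ c, (regular A).boundary n (s ((regular A).boundary n c)) = (regular A).boundary n c
  have start : p 0 0 := ⟨fun a c => by simp, fun c => by
    simp [regular_isSymmetric.boundary_zero]⟩
  let r (n : ℕ) (s : Chain A A n →L[ℂ] Chain A A (n + 1))
      (s' : Chain A A (n + 1) →L[ℂ] Chain A A (n + 2)) : Prop :=
    s.comp ((regular A).boundary n) + ((regular A).boundary (n + 1)).comp s'
      = ContinuousLinearMap.id ℂ _
  obtain ⟨s, hs⟩ := exists_seq_of_forall_exists (p := p) (r := r) start fun n s hs => by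
    obtain ⟨s', hs', hss'⟩ := hA.exists_homotopy_succ (h n) hs.1 hs.2
    refine ⟨s', ⟨hs', fun c => ?_⟩, hss'⟩
    simpa [(regular A).boundary_boundary] using
      DFunLike.congr_fun hss' ((regular A).boundary (n + 1) c)
  exact splitsAsBanachModules_iff.2 ⟨s, fun n => (hs n).1.1, fun n => (hs n).2⟩

end Construction

end BanachHochschild

end

universe u v w

open BanachHochschild in
theorem proposition3p2 (A : Type u) [NormedCommRing A] [NormedAlgebra ℂ A]
    [CompleteSpace A] (Ω : Type w) (e : A ≃L[ℂ] lp (fun _ : Ω => ℂ) 1) :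
    List.TFAE
      [∀ n : ℕ, 1 ≤ n → Subsingleton (SimplicialCohomology A n),
       ∀ n : ℕ, 1 ≤ n → Subsingleton (SimplicialHomology A n),
       SplitsAsBanachSpaces (X := fun n => Chain A A (n + 1)) (truncatedBoundary A),
       SplitsAsBanachModules (X := fun n => Chain A A (n + 1)) (truncatedAct A)
         (truncatedBoundary A),
       ∀ (M : Type (max u v)) [NormedAddCommGroup M] [NormedSpace ℂ M] [CompleteSpace M]
         (B : Bimodule A M), B.IsSymmetric → B.IsUnitLinked →
           ∀ n : ℕ, 1 ≤ n → Subsingleton (B.Cohomology n),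
       ∀ (M : Type (max u v)) [NormedAddCommGroup M] [NormedSpace ℂ M] [CompleteSpace M]
         (B : Bimodule A M), B.IsSymmetric → B.IsUnitLinked →
           ∀ n : ℕ, 1 ≤ n → Subsingleton (B.Homology n)] := by
  have hA : HasLifting ℂ A := hasLifting_of_equiv_lp_one e
  simp only [forall_one_le_iff_forall_succ]
  tfae_have 1 → 2 := fun h n => Bimodule.subsingleton_homology_of_dual _ (h n) (h (n + 1))
  tfae_have 2 → 4 := hA.splitsAsBanachModules
  tfae_have 4 → 3 := fun ⟨s, hs, _⟩ => ⟨s, hs⟩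
  tfae_have 3 → 2 := subsingleton_homology_of_splitsAsBanachSpaces
  tfae_have 4 → 5 := fun h M _ _ _ B hB hB₁ n => by
    obtain ⟨s, hact, hs⟩ := splitsAsBanachModules_iff.1 h
    exact hB.subsingleton_cohomology_of_homotopy hB₁ (hact n) (hs n)
  tfae_have 4 → 6 := fun h M _ _ _ B hB hB₁ n => by
    obtain ⟨s, hact, hs⟩ := splitsAsBanachModules_iff.1 h
    exact hB.subsingleton_homology_of_homotopy hB₁ (hact n) (hs n)
  tfae_have 5 → 1 := fun h n =>
    Bimodule.subsingleton_cohomology_of_transport _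
      (ContinuousLinearEquiv.ulift : ULift.{max u v} (StrongDual ℂ A) ≃L[ℂ] StrongDual ℂ A)
      (h _ _ (regular_isSymmetric.dual.transport _) (regular_isUnitLinked.dual.transport _) n)
  tfae_have 6 → 2 := fun h n =>
    Bimodule.subsingleton_homology_of_transport _
      (ContinuousLinearEquiv.ulift : ULift.{max u v} A ≃L[ℂ] A)
      (h _ _ (regular_isSymmetric.transport _) (regular_isUnitLinked.transport _) n)
  tfae_finish
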